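/- Let $\mathbb N=\{1,2,\dots\}$. For a nonnegative sequence $u=(u_k)_{k\ge1}$ put $m_i(u)=\sum_{k\ge1}k^iu_k$. For $n\in\mathbb N$, a sequence $c=(c_k)_{k\ge1}$ of nonnegative reals is said to solve $(E_n)$ if $$m_1(c)=1,\qquad \Big(2+\frac{k-1}{n}\Big)c_k=\frac1{m_0(c)}\sum_{i=1}^{k-1}c_ic_{k-i}\quad(k\ge2).$$ **Theorem.** For each $n\in\mathbb N$, $(E_n)$ has a unique solution $c^n=(c^n_k)_{k\ge1}$. Let $p^n_k=c^n_k/m_0(c^n)$ be the corresponding probability distribution on $\{1,2,\dots\}$. Then $$\lim_{n\to\infty}\sum_{k\ge1}|p^n_k-p_k|=0,\qquad\text{where}\quad p_k:=\frac{2}{4^k\,k}\binom{2k-2}{k-1}.$$ The sequence $(p_k)_{k\ge1}$ is the law of the number of leaves of a critical binary Galton–Watson tree, that is, of a Galton–Watson tree with offspring distribution $\frac12(\delta_0+\delta_2)$. It is the unique nonnegative solution to $$\sum_{k\ge1}p_k=1,\qquad p_k=\frac12\sum_{i=1}^{k-1}p_ip_{k-i}\quad(k\ge2).$$ Finally, $p_k\sim\dfrac{1}{2\sqrt\pi\,k^{3/2}}$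 as $k\to\infty$. -/

import Mathlib

open Filter Topology MeasureTheory ProbabilityTheory Asymptotics
open scoped ENNReal

noncomputable section

namespace ForestFire

/-! Sequences `(u_k)_{k ≥ 1}` are functions `ℕ → ℝ`; the index `0` carries no information, and
the predicates below require `u 0 = 0` so that uniqueness is meaningful. Sums over `k ≥ 1` are
written with the summation index shifted by one. -/

/-- The moment `m_i(u) = ∑_{k ≥ 1} k^i u_k`. -/
def moment (i : ℕ) (u : ℕ → ℝ) : ℝ := ∑' k : ℕ, ((k + 1 : ℕ) : ℝ) ^ i * u (k + 1)

/-- `c` is an equilibrium state with total mass `1` of the coagulation-fragmentation system with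
fire rate `1 / n`. (The sum defining `m_1` converges because its value is not `0`, and hence so
does the sum defining `m_0`.) -/
structure IsEquilibrium (n : ℕ) (c : ℕ → ℝ) : Prop where
  zero : c 0 = 0
  nonneg : ∀ k, 0 ≤ c k
  mass : moment 1 c = 1
  balance : ∀ k : ℕ, 2 ≤ k →
    (2 + ((k : ℝ) - 1) / n) * c k = 1 / moment 0 c * ∑ i ∈ Finset.Ico 1 k, c i * c (k - i)

/-- The particles' mass distribution `c_k / m_0(c)`. -/
def massDist (c : ℕ → ℝ) (k : ℕ) : ℝ := c k / moment 0 c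

/-- The limit law `p_k = 2 / (4^k k) * binom (2k-2) (k-1)` for `k ≥ 1`, with `p_0 = 0`. -/
def limitLaw (k : ℕ) : ℝ :=
  if k = 0 then 0 else 2 / (4 ^ k * (k : ℝ)) * (Nat.choose (2 * k - 2) (k - 1) : ℝ)

/-- Nonnegative solutions of `∑_{k ≥ 1} q_k = 1`, `q_k = 1/2 ∑_{i=1}^{k-1} q_i q_{k-i}`, `k ≥ 2`. -/
structure IsLimitSolution (q : ℕ → ℝ) : Prop where
  zero : q 0 = 0
  nonneg : ∀ k, 0 ≤ q k
  hasSum : HasSum (fun k => q (k + 1)) 1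
  balance : ∀ k : ℕ, 2 ≤ k → q k = 1 / 2 * ∑ i ∈ Finset.Ico 1 k, q i * q (k - i)

/-- The rooted tree, as a set of words (the root is `[]`, the children of `u` are `u ++ [i]`),
in which the individual `u` has the `ξ u` children `u ++ [0], …, u ++ [ξ u - 1]`. -/
def tree (ξ : List ℕ → ℕ) : Set (List ℕ) := {u | ∀ v i, v ++ [i] <+: u → i < ξ v}

/-- The leaves of the tree: its vertices without children. -/
def leaves (ξ : List ℕ → ℕ) : Set (List ℕ) := {u | u ∈ tree ξ ∧ ξ u = 0}

/-- The numbers of children `ξ u` of all potential individuals are independent with law `ν`, that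
is, `tree (fun u => ξ u ω)` is a Galton-Watson tree with offspring distribution `ν`. -/
structure IsGaltonWatson {Ω : Type*} [MeasurableSpace Ω] (P : Measure Ω) (ν : Measure ℕ)
    (ξ : List ℕ → Ω → ℕ) : Prop where
  measurable : ∀ u, Measurable (ξ u)
  indep : iIndepFun ξ P
  law : ∀ u, P.map (ξ u) = ν

/-- The critical binary offspring distribution `(δ_0 + δ_2) / 2`. -/
def criticalBinary : Measure ℕ :=
  (2⁻¹ : ℝ≥0∞) • (Measure.dirac 0 + Measure.dirac 2)

end ForestFire

end

/-!
Dividing by `m_0`, a solution of `(E_n)` is a probability law `p` with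
`w_k p_k = ∑_{i=1}^{k-1} p_i p_{k-i}` and `w_k = 2 + (k - 1) / n`; the limit law solves the same
recursion with `w = 2`. If `b` is the solution started from `b_1 = 1`, the solution started from
`x` is `b_k x ^ k`, so that laws correspond to the roots of `G x = ∑ b_k x ^ k = 1`.

Solutions increase with their first term and decrease with the weights, so a law is unique. For
existence, splitting off the finitely many indices with `w_k < 8` bounds the partial sums `S_m`
of the series `G` by `S_{m+1} ≤ A + S_m² / 8`. Hence they stay bounded slightly beyond any point
where they are at most `1`, so `G` does not jump over `1` and the resulting law has finite moments.

As `n → ∞` the weights decrease to `2`, the roots converge by dominated convergence, and Scheffé's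
argument turns the termwise convergence into convergence in `ℓ¹`.

The number of leaves of the critical binary tree is, with probability one half each, `1` or the
sum of two independent copies of itself. This is the recursion with `w = 2` once
`P(N = 0) = P(N = 0)² / 2` has forced `P(N = 0) = 0`.
-/

namespace ForestFire

open Finset.HasAntidiagonal (antidiagonal mem_antidiagonal)

section ConvSolution

theorem sum_Ico_one_eq_sum_antidiagonal {M : Type*} [AddCommMonoid M] (f : ℕ → ℕ → M) (k : ℕ) :
    ∑ i ∈ Finset.Ico 1 (k + 2), f i (k + 2 - i) =
      ∑ ij ∈ antidiagonal k, f (ij.1 + 1) (ij.2 + 1) := by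
  rw [Finset.Nat.sum_antidiagonal_eq_sum_range_succ fun i j => f (i + 1) (j + 1),
    Finset.sum_Ico_eq_sum_range]
  refine Finset.sum_congr rfl fun i hi => ?_
  rw [Finset.mem_range] at hi
  rw [add_comm 1 i, show k + 2 - (i + 1) = k - i + 1 by lia]

/-- Nonnegative solutions of the quadratic recursion `w_k q_k = ∑_{i=1}^{k-1} q_i q_{k-i}`, `k ≥ 2`,
common to the equilibria of the system and to its limit law. Only the weights `w_k`, `k ≥ 2`,
matter. -/
structure IsConvSolution (w q : ℕ → ℝ) : Prop where
  zero : q 0 = 0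
  nonneg : ∀ k, 0 ≤ q k
  balance : ∀ k : ℕ, 2 ≤ k → w k * q k = ∑ i ∈ Finset.Ico 1 k, q i * q (k - i)

/-- Solutions of the recursion that are probability distributions on `{1, 2, …}`. -/
structure IsConvLaw (w q : ℕ → ℝ) : Prop extends IsConvSolution w q where
  hasSum : HasSum (fun k => q (k + 1)) 1

/-- The solution of the recursion with weights `w` started from `q_1 = 1`. -/
noncomputable def convSolution (w : ℕ → ℝ) : ℕ → ℝ
  | 0 => 0
  | 1 => 1
  | k + 2 => (∑ i : Fin (k + 1), convSolution w (i + 1) * convSolution w (k - i + 1)) / w (k + 2)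

variable {ι : Type*} {v w q q' : ℕ → ℝ} {x : ℝ}

theorem IsConvSolution.balance_add_two (h : IsConvSolution w q) (k : ℕ) :
    w (k + 2) * q (k + 2) = ∑ ij ∈ antidiagonal k, q (ij.1 + 1) * q (ij.2 + 1) := by
  rw [h.balance _ (Nat.le_add_left 2 k), sum_Ico_one_eq_sum_antidiagonal fun i j => q i * q j]

theorem IsConvSolution.le (hv : ∀ k, 2 ≤ k → 0 < v k) (hvw : ∀ k, 2 ≤ k → v k ≤ w k)
    (h : IsConvSolution w q) (h' : IsConvSolution v q') (h1 : q 1 ≤ q' 1) (k : ℕ) :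
    q k ≤ q' k := by
  induction k using Nat.strong_induction_on with
  | _ k ih =>
    match k with
    | 0 => rw [h.zero, h'.zero]
    | 1 => exact h1
    | k + 2 =>
      have hk : 2 ≤ k + 2 := Nat.le_add_left 2 k
      refine le_of_mul_le_mul_left ?_ (hv _ hk)
      calc v (k + 2) * q (k + 2) ≤ w (k + 2) * q (k + 2) :=
            mul_le_mul_of_nonneg_right (hvw _ hk) (h.nonneg _)
        _ = ∑ ij ∈ antidiagonal k, q (ij.1 + 1) * q (ij.2 + 1) := h.balance_add_two k
        _ ≤ ∑ ij ∈ antidiagonal k, q' (ij.1 + 1) * q' (ij.2 + 1) := by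
          refine Finset.sum_le_sum fun ij hij => ?_
          rw [mem_antidiagonal] at hij
          exact mul_le_mul (ih _ (by lia)) (ih _ (by lia)) (h.nonneg _) (h'.nonneg _)
        _ = v (k + 2) * q' (k + 2) := (h'.balance_add_two k).symm

theorem IsConvSolution.eq_of_apply_one (hw : ∀ k, 2 ≤ k → 0 < w k) (h : IsConvSolution w q)
    (h' : IsConvSolution w q') (h1 : q 1 = q' 1) : q = q' :=
  funext fun k => (h.le hw (fun _ _ => le_rfl) h' h1.le k).antisymm
    (h'.le hw (fun _ _ => le_rfl) h h1.ge k)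

theorem IsConvSolution.mul_pow (h : IsConvSolution w q) (hx : 0 ≤ x) :
    IsConvSolution w fun k => q k * x ^ k where
  zero := by rw [h.zero, zero_mul]
  nonneg k := mul_nonneg (h.nonneg k) (pow_nonneg hx k)
  balance k hk := by
    rw [← mul_assoc, h.balance k hk, Finset.sum_mul]
    refine Finset.sum_congr rfl fun i hi => ?_
    rw [mul_mul_mul_comm, ← pow_add, Nat.add_sub_cancel' (Finset.mem_Ico.1 hi).2.le]

theorem convSolution_zero (w : ℕ → ℝ) : convSolution w 0 = 0 := by rw [convSolution]

theorem convSolution_one (w : ℕ → ℝ) : convSolution w 1 = 1 := by rw [convSolution]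

theorem convSolution_add_two (w : ℕ → ℝ) (k : ℕ) : convSolution w (k + 2) =
    (∑ ij ∈ antidiagonal k, convSolution w (ij.1 + 1) * convSolution w (ij.2 + 1)) /
      w (k + 2) := by
  rw [convSolution, Fin.sum_univ_eq_sum_range
    (fun i => convSolution w (i + 1) * convSolution w (k - i + 1)) (k + 1),
    Finset.Nat.sum_antidiagonal_eq_sum_range_succ
      fun i j => convSolution w (i + 1) * convSolution w (j + 1)]

theorem convSolution_nonneg (hw : ∀ k, 2 ≤ k → 0 < w k) (k : ℕ) : 0 ≤ convSolution w k := by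
  induction k using Nat.strong_induction_on with
  | _ k ih =>
    match k with
    | 0 => rw [convSolution_zero]
    | 1 => rw [convSolution_one]; exact zero_le_one
    | k + 2 =>
      rw [convSolution_add_two]
      refine div_nonneg (Finset.sum_nonneg fun ij hij => ?_) (hw _ (Nat.le_add_left 2 k)).le
      rw [mem_antidiagonal] at hij
      exact mul_nonneg (ih _ (by lia)) (ih _ (by lia))

theorem isConvSolution_convSolution (hw : ∀ k, 2 ≤ k → 0 < w k) :
    IsConvSolution w (convSolution w) where
  zero := convSolution_zero w
  nonneg := convSolution_nonneg hw
  balance k hk := by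
    have hwk := hw k hk
    obtain ⟨k, rfl⟩ := Nat.exists_eq_add_of_le' hk
    rw [sum_Ico_one_eq_sum_antidiagonal fun i j => convSolution w i * convSolution w j,
      convSolution_add_two, mul_div_cancel₀ _ hwk.ne']

theorem IsConvSolution.eq_convSolution_mul_pow (hw : ∀ k, 2 ≤ k → 0 < w k)
    (h : IsConvSolution w q) : q = fun k => convSolution w k * q 1 ^ k :=
  h.eq_of_apply_one hw ((isConvSolution_convSolution hw).mul_pow (h.nonneg 1))
    (by simp [convSolution_one])

theorem tendsto_convSolution {w : ι → ℕ → ℝ} {l : Filter ι} (hv : ∀ k, 2 ≤ k → v k ≠ 0)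
    (hw : ∀ k, 2 ≤ k → Tendsto (fun n => w n k) l (𝓝 (v k))) (k : ℕ) :
    Tendsto (fun n => convSolution (w n) k) l (𝓝 (convSolution v k)) := by
  induction k using Nat.strong_induction_on with
  | _ k ih =>
    match k with
    | 0 => simp only [convSolution_zero, tendsto_const_nhds]
    | 1 => simp only [convSolution_one, tendsto_const_nhds]
    | k + 2 =>
      have hk : 2 ≤ k + 2 := Nat.le_add_left 2 k
      simp only [convSolution_add_two]
      refine (tendsto_finsetSum _ fun ij hij => ?_).div (hw _ hk) (hv _ hk)
      rw [mem_antidiagonal] at hij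
      exact (ih _ (by lia)).mul (ih _ (by lia))

theorem eq_of_hasSum_of_le {f g : ι → ℝ} {a : ℝ} (hf : HasSum f a) (hg : HasSum g a)
    (hfg : f ≤ g) : f = g := by
  have h := hg.sub hf
  rw [sub_self, hasSum_zero_iff_of_nonneg fun i => sub_nonneg.2 (hfg i)] at h
  exact (sub_eq_zero.1 h).symm

theorem IsConvLaw.apply_one_le (hv : ∀ k, 2 ≤ k → 0 < v k) (hvw : ∀ k, 2 ≤ k → v k ≤ w k)
    (h : IsConvLaw v q) (h' : IsConvLaw w q') : q 1 ≤ q' 1 := by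
  by_contra! h1
  exact h1.ne (congrFun (eq_of_hasSum_of_le h'.hasSum h.hasSum fun k =>
    h'.le hv hvw h.toIsConvSolution h1.le (k + 1)) 0)

theorem IsConvLaw.unique (hw : ∀ k, 2 ≤ k → 0 < w k) (h : IsConvLaw w q)
    (h' : IsConvLaw w q') : q = q' :=
  h.eq_of_apply_one hw h'.toIsConvSolution
    ((h.apply_one_le hw (fun _ _ => le_rfl) h').antisymm
      (h'.apply_one_le hw (fun _ _ => le_rfl) h))

end ConvSolution

section Existence

variable {w q : ℕ → ℝ} {x y : ℝ}

theorem sum_range_sum_antidiagonal_le_sq {a : ℕ → ℝ} (ha : ∀ k, 0 ≤ a k) (m : ℕ) :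
    ∑ j ∈ Finset.range m, ∑ ij ∈ antidiagonal j, a ij.1 * a ij.2 ≤
      (∑ i ∈ Finset.range m, a i) ^ 2 := by
  simp only [Finset.Nat.sum_antidiagonal_eq_sum_range_succ fun i j => a i * a j]
  rw [Finset.sum_range_diag_flip m fun i j => a i * a j, sq, Finset.sum_mul]
  refine Finset.sum_le_sum fun i _ => ?_
  rw [← Finset.mul_sum]
  exact mul_le_mul_of_nonneg_left (Finset.sum_le_sum_of_subset_of_nonneg
    (Finset.range_mono (Nat.sub_le m i)) fun j _ _ => ha j) (ha i)

theorem IsConvSolution.sum_range_succ_le (h : IsConvSolution w q) {C : ℝ} {K : ℕ} (hC : 0 < C)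
    (hw : ∀ k, K ≤ k → C ≤ w (k + 2)) (m : ℕ) :
    ∑ k ∈ Finset.range (m + 1), q (k + 1) ≤
      ∑ k ∈ Finset.range (K + 1), q (k + 1) + (∑ k ∈ Finset.range m, q (k + 1)) ^ 2 / C := by
  rcases le_total m K with hm | hm
  · exact le_add_of_le_of_nonneg (Finset.sum_le_sum_of_subset_of_nonneg
      (Finset.range_mono (Nat.succ_le_succ hm)) fun k _ _ => h.nonneg _) (by positivity)
  rw [← Finset.sum_range_add_sum_Ico _ (Nat.succ_le_succ hm)]
  refine add_le_add_right ((le_div_iff₀ hC).2 ?_) _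
  calc (∑ k ∈ Finset.Ico (K + 1) (m + 1), q (k + 1)) * C
      = ∑ k ∈ Finset.Ico K m, C * q (k + 2) := by
        rw [← Finset.sum_Ico_add' _ K m 1, mul_comm, Finset.mul_sum]
    _ ≤ ∑ k ∈ Finset.Ico K m, w (k + 2) * q (k + 2) := Finset.sum_le_sum fun k hk =>
        mul_le_mul_of_nonneg_right (hw k (Finset.mem_Ico.1 hk).1) (h.nonneg _)
    _ = ∑ k ∈ Finset.Ico K m, ∑ ij ∈ antidiagonal k, q (ij.1 + 1) * q (ij.2 + 1) :=
        Finset.sum_congr rfl fun k _ => h.balance_add_two k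
    _ ≤ ∑ k ∈ Finset.range m, ∑ ij ∈ antidiagonal k, q (ij.1 + 1) * q (ij.2 + 1) :=
        Finset.sum_le_sum_of_subset_of_nonneg
          (fun k hk => Finset.mem_range.2 (Finset.mem_Ico.1 hk).2)
          fun k _ _ => Finset.sum_nonneg fun _ _ => mul_nonneg (h.nonneg _) (h.nonneg _)
    _ ≤ (∑ k ∈ Finset.range m, q (k + 1)) ^ 2 :=
        sum_range_sum_antidiagonal_le_sq (fun k => h.nonneg (k + 1)) m

/-- The partial sums of the generating function of the solution started from `q_1 = 1`. -/
noncomputable def truncGen (w : ℕ → ℝ) (m : ℕ) (x : ℝ) : ℝ :=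
  ∑ k ∈ Finset.range m, convSolution w (k + 1) * x ^ (k + 1)

theorem continuous_truncGen (w : ℕ → ℝ) (m : ℕ) : Continuous (truncGen w m) :=
  continuous_finsetSum _ fun _ _ => continuous_const.mul (continuous_pow _)

theorem truncGen_one (w : ℕ → ℝ) (x : ℝ) : truncGen w 1 x = x := by
  simp [truncGen, convSolution_one]

theorem exists_gt_forall_truncGen_le_two (hw : ∀ k, 2 ≤ k → 0 < w k) (hlim : Tendsto w atTop atTop)
    (hx : 0 ≤ x) (h : ∀ m, truncGen w m x ≤ 1) : ∃ y > x, ∀ m, truncGen w m y ≤ 2 := by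
  obtain ⟨K, hK⟩ := eventually_atTop.1 (hlim.eventually_ge_atTop 8)
  have hnear : ∀ᶠ y in 𝓝 x, truncGen w (K + 1) y < 3 / 2 :=
    (continuous_truncGen w (K + 1)).continuousAt.eventually_lt_const
      ((h (K + 1)).trans_lt (by norm_num))
  obtain ⟨y, hyK, hxy⟩ :=
    ((hnear.filter_mono nhdsWithin_le_nhds).and (self_mem_nhdsWithin (s := Set.Ioi x))).exists
  have hy : 0 ≤ y := hx.trans (Set.mem_Ioi.1 hxy).le
  refine ⟨y, hxy, fun m => ?_⟩
  induction m with
  | zero => simp [truncGen]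
  | succ m ih =>
    have hnonneg : 0 ≤ truncGen w m y := Finset.sum_nonneg fun k _ =>
      mul_nonneg (convSolution_nonneg hw _) (pow_nonneg hy _)
    calc truncGen w (m + 1) y ≤ truncGen w (K + 1) y + truncGen w m y ^ 2 / 8 :=
          ((isConvSolution_convSolution hw).mul_pow hy).sum_range_succ_le (by norm_num)
            (fun k hk => hK _ (by lia)) m
      _ ≤ 3 / 2 + 2 ^ 2 / 8 := by gcongr
      _ = 2 := by norm_num

theorem summable_mul_pow_of_le {a : ℕ → ℝ} (ha : ∀ k, 0 ≤ a k)
    (hy : Summable fun k => a k * y ^ (k + 1)) (hx : 0 ≤ x) (hxy : x ≤ y) :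
    Summable fun k => a k * x ^ (k + 1) :=
  hy.of_nonneg_of_le (fun k => mul_nonneg (ha k) (pow_nonneg hx _))
    fun k => mul_le_mul_of_nonneg_left (pow_le_pow_left₀ hx hxy _) (ha k)

theorem continuousOn_tsum_mul_pow {a : ℕ → ℝ} (ha : ∀ k, 0 ≤ a k)
    (hy : Summable fun k => a k * y ^ (k + 1)) :
    ContinuousOn (fun x => ∑' k, a k * x ^ (k + 1)) (Set.Icc 0 y) := by
  refine continuousOn_tsum (fun k => by fun_prop) hy fun k x hx => ?_
  rw [Real.norm_of_nonneg (mul_nonneg (ha k) (pow_nonneg hx.1 _))]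
  exact mul_le_mul_of_nonneg_left (pow_le_pow_left₀ hx.1 hx.2 _) (ha k)

theorem isCompact_setOf_truncGen_le_one (w : ℕ → ℝ) :
    IsCompact {x : ℝ | 0 ≤ x ∧ ∀ m, truncGen w m x ≤ 1} := by
  refine (isCompact_Icc (a := (0 : ℝ)) (b := 1)).of_isClosed_subset ?_
    fun x hx => ⟨hx.1, truncGen_one w x ▸ hx.2 1⟩
  simp only [Set.ofPred_and, Set.ofPred_forall]
  exact isClosed_Ici.inter (isClosed_iInter fun m =>
    isClosed_le (continuous_truncGen w m) continuous_const)

theorem exists_hasSum_convSolution_mul_pow (hw : ∀ k, 2 ≤ k → 0 < w k)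
    (hlim : Tendsto w atTop atTop) : ∃ x y, 0 ≤ x ∧ x < y ∧ (∀ m, truncGen w m y ≤ 2) ∧
      HasSum (fun k => convSolution w (k + 1) * x ^ (k + 1)) 1 := by
  obtain ⟨x, ⟨hx, hx1⟩, hmax⟩ := (isCompact_setOf_truncGen_le_one w).exists_isGreatest
    ⟨0, le_rfl, fun m => by simp [truncGen]⟩
  obtain ⟨y, hxy, hy⟩ := exists_gt_forall_truncGen_le_two hw hlim hx hx1
  have hb : ∀ k, 0 ≤ convSolution w (k + 1) := fun k => convSolution_nonneg hw _
  have hnonneg : ∀ z, 0 ≤ z → ∀ k, 0 ≤ convSolution w (k + 1) * z ^ (k + 1) := fun z hz k =>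
    mul_nonneg (hb k) (pow_nonneg hz _)
  have hsumy : Summable fun k => convSolution w (k + 1) * y ^ (k + 1) :=
    summable_of_sum_range_le (hnonneg y (hx.trans hxy.le)) hy
  have hsum : ∀ z, 0 ≤ z → z ≤ y → Summable fun k => convSolution w (k + 1) * z ^ (k + 1) :=
    fun z => summable_mul_pow_of_le hb hsumy
  let G : ℝ → ℝ := fun z => ∑' k, convSolution w (k + 1) * z ^ (k + 1)
  have hle : ∀ z, 0 ≤ z → z ≤ y → G z ≤ 1 → z ≤ x := fun z hz hzy h1 =>
    hmax ⟨hz, fun m => ((hsum z hz hzy).sum_le_tsum _ fun k _ => hnonneg z hz k).trans h1⟩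
  have hGx : G x ≤ 1 := (hsum x hx hxy.le).tsum_le_of_sum_range_le hx1
  have hGy : 1 ≤ G y := by
    by_contra! h1
    exact (hle y (hx.trans hxy.le) le_rfl h1.le).not_gt hxy
  obtain ⟨z, hz, hGz⟩ := intermediate_value_Icc hxy.le
    ((continuousOn_tsum_mul_pow hb hsumy).mono (Set.Icc_subset_Icc_left hx)) ⟨hGx, hGy⟩
  obtain rfl : z = x := (hle z (hx.trans hz.1) hz.2 hGz.le).antisymm hz.1
  exact ⟨z, y, hx, hxy, hy, hGz ▸ (hsum z hx hxy.le).hasSum⟩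

theorem summable_pow_mul_mul_pow {a : ℕ → ℝ} {C : ℝ} (ha : ∀ k, 0 ≤ a k)
    (hC : ∀ k, a k * y ^ k ≤ C) (hx : 0 ≤ x) (hxy : x < y) (i : ℕ) :
    Summable fun k : ℕ => (k : ℝ) ^ i * (a k * x ^ k) := by
  have hy : 0 < y := hx.trans_lt hxy
  have hr : ‖x / y‖ < 1 := by
    rwa [Real.norm_of_nonneg (by positivity), div_lt_one hy]
  refine ((summable_pow_mul_geometric_of_norm_lt_one i hr).mul_left C).of_nonneg_of_le
    (fun k => mul_nonneg (by positivity) (mul_nonneg (ha k) (by positivity))) fun k => ?_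
  calc (k : ℝ) ^ i * (a k * x ^ k) = (a k * y ^ k) * (k ^ i * (x / y) ^ k) := by
        rw [div_pow]; field_simp
    _ ≤ C * (k ^ i * (x / y) ^ k) := mul_le_mul_of_nonneg_right (hC k) (by positivity)

theorem exists_isConvLaw (hw : ∀ k, 2 ≤ k → 0 < w k) (hlim : Tendsto w atTop atTop) :
    ∃ q, IsConvLaw w q ∧ ∀ i : ℕ, Summable fun k => ((k + 1 : ℕ) : ℝ) ^ i * q (k + 1) := by
  obtain ⟨x, y, hx, hxy, hy, hsum⟩ := exists_hasSum_convSolution_mul_pow hw hlim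
  refine ⟨fun k => convSolution w k * x ^ k,
    ⟨(isConvSolution_convSolution hw).mul_pow hx, hsum⟩, fun i => ?_⟩
  refine (summable_nat_add_iff 1).2 (summable_pow_mul_mul_pow (C := 2)
    (convSolution_nonneg hw) (fun k => ?_) hx hxy i)
  rcases k with _ | k
  · simp [convSolution_zero]
  · refine le_trans ?_ (hy (k + 1))
    exact Finset.single_le_sum (f := fun k => convSolution w (k + 1) * y ^ (k + 1))
      (fun k _ => mul_nonneg (convSolution_nonneg hw _) (pow_nonneg (hx.trans hxy.le) _))
      (Finset.self_mem_range_succ k)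

end Existence

section Convergence

variable {ι : Type*} {l : Filter ι} {v q : ℕ → ℝ} {w Q : ι → ℕ → ℝ}

theorem IsConvLaw.apply_one_le_add_one_sub_tsum {w q : ℕ → ℝ} {x : ℝ}
    (hw : ∀ k, 2 ≤ k → 0 < w k) (h : IsConvLaw w q) (hx : 0 ≤ x) (hxq : x ≤ q 1) :
    q 1 ≤ x + (1 - ∑' k, convSolution w (k + 1) * x ^ (k + 1)) := by
  have hle : ∀ k, convSolution w k * x ^ k ≤ q k := fun k =>
    ((isConvSolution_convSolution hw).mul_pow hx).le hw (fun _ _ => le_rfl) h.toIsConvSolution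
      (by simpa [convSolution_one] using hxq) k
  have hsum : Summable fun k => convSolution w (k + 1) * x ^ (k + 1) :=
    h.hasSum.summable.of_nonneg_of_le
      (fun k => mul_nonneg (convSolution_nonneg hw _) (pow_nonneg hx _)) fun k => hle (k + 1)
  have hfirst := le_hasSum (h.hasSum.sub hsum.hasSum) 0 fun k _ => sub_nonneg.2 (hle (k + 1))
  simp only [zero_add, convSolution_one, one_mul, pow_one] at hfirst
  linarith

theorem tendsto_tsum_convSolution (hv : ∀ k, 2 ≤ k → 0 < v k)
    (hvw : ∀ᶠ n in l, ∀ k, 2 ≤ k → v k ≤ w n k)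
    (hw : ∀ k, 2 ≤ k → Tendsto (fun n => w n k) l (𝓝 (v k))) (h : IsConvLaw v q) :
    Tendsto (fun n => ∑' k, convSolution (w n) (k + 1) * q 1 ^ (k + 1)) l (𝓝 1) := by
  have hsum := h.hasSum
  rw [h.eq_convSolution_mul_pow hv] at hsum
  rw [← hsum.tsum_eq]
  refine tendsto_tsum_of_dominated_convergence hsum.summable (fun k =>
    (tendsto_convSolution (fun k hk => (hv k hk).ne') hw (k + 1)).mul_const _) ?_
  filter_upwards [hvw] with n hn k
  have hwn : ∀ k, 2 ≤ k → 0 < w n k := fun k hk => (hv k hk).trans_le (hn k hk)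
  rw [Real.norm_of_nonneg (mul_nonneg (convSolution_nonneg hwn _) (pow_nonneg (h.nonneg 1) _))]
  refine mul_le_mul_of_nonneg_right ?_ (pow_nonneg (h.nonneg 1) _)
  exact (isConvSolution_convSolution hwn).le hv hn (isConvSolution_convSolution hv)
    (by rw [convSolution_one, convSolution_one]) _

theorem IsConvLaw.tendsto (hv : ∀ k, 2 ≤ k → 0 < v k)
    (hvw : ∀ᶠ n in l, ∀ k, 2 ≤ k → v k ≤ w n k)
    (hw : ∀ k, 2 ≤ k → Tendsto (fun n => w n k) l (𝓝 (v k))) (h : IsConvLaw v q)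
    (hQ : ∀ᶠ n in l, IsConvLaw (w n) (Q n)) (k : ℕ) :
    Tendsto (fun n => Q n k) l (𝓝 (q k)) := by
  have hpos : ∀ᶠ n in l, ∀ k, 2 ≤ k → 0 < w n k := by
    filter_upwards [hvw] with n hn k hk using (hv k hk).trans_le (hn k hk)
  have hge : ∀ᶠ n in l, q 1 ≤ Q n 1 := by
    filter_upwards [hvw, hQ] with n hn hQn using h.apply_one_le hv hn hQn
  have hone : Tendsto (fun n => Q n 1) l (𝓝 (q 1)) := by
    have hupper := ((tendsto_tsum_convSolution hv hvw hw h).const_sub 1).const_add (q 1)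
    rw [sub_self, add_zero] at hupper
    refine tendsto_of_tendsto_of_tendsto_of_le_of_le' tendsto_const_nhds hupper hge ?_
    filter_upwards [hpos, hQ, hge] with n hn hQn hgen using
      hQn.apply_one_le_add_one_sub_tsum hn (h.nonneg 1) hgen
  rw [h.eq_convSolution_mul_pow hv]
  refine ((tendsto_convSolution (fun k hk => (hv k hk).ne') hw k).mul (hone.pow k)).congr' ?_
  filter_upwards [hpos, hQ] with n hn hQn using
    (congrFun (hQn.eq_convSolution_mul_pow hn) k).symm

-- Scheffé's argument: `|f - g| = (f - g) + 2 (g - f)⁺`, where `(g - f)⁺ ≤ g` is dominated.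
theorem tendsto_tsum_abs_sub_of_hasSum {β : Type*} {f : ι → β → ℝ} {g : β → ℝ} {a : ℝ}
    (hf0 : ∀ᶠ n in l, 0 ≤ f n) (hf : ∀ᶠ n in l, HasSum (f n) a)
    (hg0 : 0 ≤ g) (hg : HasSum g a) (hlim : Tendsto f l (𝓝 g)) :
    Tendsto (fun n => ∑' b, |f n b - g b|) l (𝓝 0) := by
  have hdom : Tendsto (fun n => ∑' b, (g b - f n b)⁺) l (𝓝 (∑' _ : β, (0 : ℝ))) := by
    refine tendsto_tsum_of_dominated_convergence hg.summable (fun b => ?_) ?_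
    · simpa [posPart_def] using
        ((tendsto_pi_nhds.1 hlim b).const_sub (g b)).max (tendsto_const_nhds (x := (0 : ℝ)))
    · filter_upwards [hf0] with n hn b
      rw [Real.norm_of_nonneg (posPart_nonneg _)]
      exact sup_le (sub_le_self _ (hn b)) (hg0 b)
  rw [tsum_zero] at hdom
  have hdom2 := hdom.const_mul 2
  rw [mul_zero] at hdom2
  refine hdom2.congr' ?_
  filter_upwards [hf0, hf] with n hn0 hn
  have hpos : Summable fun b => (g b - f n b)⁺ :=
    hg.summable.of_nonneg_of_le (fun b => posPart_nonneg _)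
      fun b => sup_le (sub_le_self _ (hn0 b)) (hg0 b)
  have hsum := (hn.sub hg).add (hpos.hasSum.mul_left 2)
  rw [sub_self, zero_add] at hsum
  rw [← hsum.tsum_eq]
  refine tsum_congr fun b => ?_
  rw [abs_sub_comm]
  have h1 := posPart_add_negPart (g b - f n b)
  have h2 := posPart_sub_negPart (g b - f n b)
  linarith

end Convergence

section CentralBinom

theorem centralBinom_div_four_pow_eq (n : ℕ) :
    (Nat.centralBinom n : ℝ) / 4 ^ n = 1 / √(Real.Wallis.W n * (2 * n + 1)) := by
  have hfac : (Nat.centralBinom n : ℝ) * ((n.factorial : ℝ) * n.factorial) =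
      (2 * n).factorial := by
    have := Nat.choose_mul_factorial_mul_factorial (show n ≤ 2 * n by lia)
    rw [show 2 * n - n = n by lia, mul_assoc, ← Nat.centralBinom_eq_two_mul_choose] at this
    exact_mod_cast this
  have hpow : (2 : ℝ) ^ (4 * n) = (4 ^ n) ^ 2 := by
    rw [← pow_mul, show (4 : ℝ) = 2 ^ 2 by norm_num, ← pow_mul]
    ring_nf
  have hW : Real.Wallis.W n * (2 * n + 1) = (4 ^ n / (Nat.centralBinom n : ℝ)) ^ 2 := by
    have hb := Nat.centralBinom_pos n
    rw [Real.Wallis.W_eq_factorial_ratio, ← hfac, hpow]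
    field_simp
  rw [hW, Real.sqrt_sq (by positivity), one_div_div]

theorem isEquivalent_natCast_mul_add {a : ℝ} (ha : a ≠ 0) (b : ℝ) :
    (fun n : ℕ => a * n + b) ~[atTop] fun n : ℕ => a * n :=
  IsEquivalent.refl.add_isLittleO <|
    (isLittleO_const_id_atTop b).natCast_atTop.trans_isBigO ((isBigO_refl _ _).const_mul_right ha)

theorem centralBinom_div_four_pow_isEquivalent :
    (fun n : ℕ => (Nat.centralBinom n : ℝ) / 4 ^ n) ~[atTop] fun n : ℕ => 1 / √(Real.pi * n) := by
  have hW : Real.Wallis.W ~[atTop] fun _ => Real.pi / 2 :=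
    (isEquivalent_const_iff_tendsto (by positivity)).2 Real.Wallis.tendsto_W_nhds_pi_div_two
  have hmul : (fun n : ℕ => Real.Wallis.W n * (2 * n + 1)) ~[atTop] fun n : ℕ => Real.pi * n := by
    refine (hW.mul (isEquivalent_natCast_mul_add two_ne_zero 1)).congr_right (.of_eq ?_)
    ext n
    simp only [Pi.mul_apply]
    ring
  have hsqrt := (hmul.rpow (r := 1 / 2) fun n => by positivity).inv
  simpa [centralBinom_div_four_pow_eq, Real.sqrt_eq_rpow] using! hsqrt

theorem tendsto_centralBinom_div_four_pow :
    Tendsto (fun n : ℕ => (Nat.centralBinom n : ℝ) / 4 ^ n) atTop (𝓝 0) := by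
  refine centralBinom_div_four_pow_isEquivalent.symm.tendsto_nhds ?_
  simp only [one_div]
  exact (Real.tendsto_sqrt_atTop.comp
    (tendsto_natCast_atTop_atTop.const_mul_atTop Real.pi_pos)).inv_tendsto_atTop

end CentralBinom

section LimitLaw

theorem limitLaw_zero : limitLaw 0 = 0 := if_pos rfl

theorem limitLaw_succ_eq_catalan (k : ℕ) : limitLaw (k + 1) = (catalan k : ℝ) / (2 * 4 ^ k) := by
  have h : ((k : ℝ) + 1) * catalan k = Nat.centralBinom k := by
    exact_mod_cast succ_mul_catalan_eq_centralBinom k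
  rw [limitLaw, if_neg k.succ_ne_zero, show 2 * (k + 1) - 2 = 2 * k by lia, Nat.add_sub_cancel,
    ← Nat.centralBinom_eq_two_mul_choose, ← h]
  push_cast
  field_simp
  ring

theorem limitLaw_one : limitLaw 1 = 1 / 2 := by
  simp [limitLaw_succ_eq_catalan 0]

theorem limitLaw_nonneg (k : ℕ) : 0 ≤ limitLaw k := by
  rw [limitLaw]
  split_ifs <;> positivity

theorem limitLaw_succ_eq_centralBinom_succ (k : ℕ) :
    limitLaw (k + 1) = (Nat.centralBinom (k + 1) : ℝ) / 4 ^ (k + 1) / (2 * k + 1) := by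
  have hc : ((k : ℝ) + 1) * catalan k = Nat.centralBinom k := by
    exact_mod_cast succ_mul_catalan_eq_centralBinom k
  have hb : ((k : ℝ) + 1) * Nat.centralBinom (k + 1) = 2 * (2 * k + 1) * Nat.centralBinom k := by
    exact_mod_cast Nat.succ_mul_centralBinom_succ k
  rw [limitLaw_succ_eq_catalan]
  have hk : (k : ℝ) + 1 ≠ 0 := by positivity
  field_simp
  refine mul_left_cancel₀ hk ?_
  linear_combination 4 ^ (k + 1) * (2 * k + 1) * hc - 2 * 4 ^ k * hb

theorem sum_range_limitLaw_succ (n : ℕ) :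
    ∑ k ∈ Finset.range n, limitLaw (k + 1) = 1 - (Nat.centralBinom n : ℝ) / 4 ^ n := by
  induction n with
  | zero => simp
  | succ n ih =>
    have hb : (Nat.centralBinom n : ℝ) =
        (n + 1) * Nat.centralBinom (n + 1) / (2 * (2 * n + 1)) := by
      rw [eq_div_iff (by positivity), mul_comm]
      exact_mod_cast (Nat.succ_mul_centralBinom_succ n).symm
    rw [Finset.sum_range_succ, ih, limitLaw_succ_eq_centralBinom_succ, hb]
    field_simp
    ring

theorem isConvLaw_limitLaw : IsConvLaw (fun _ => 2) limitLaw where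
  zero := limitLaw_zero
  nonneg := limitLaw_nonneg
  balance k hk := by
    obtain ⟨k, rfl⟩ := Nat.exists_eq_add_of_le' hk
    rw [sum_Ico_one_eq_sum_antidiagonal fun i j => limitLaw i * limitLaw j,
      limitLaw_succ_eq_catalan (k + 1), catalan_succ']
    push_cast
    rw [Finset.sum_div, Finset.mul_sum]
    refine Finset.sum_congr rfl fun ij hij => ?_
    rw [limitLaw_succ_eq_catalan, limitLaw_succ_eq_catalan, ← mem_antidiagonal.1 hij]
    field_simp
    ring
  hasSum := by
    rw [hasSum_iff_tendsto_nat_of_nonneg fun k => limitLaw_nonneg _]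
    simp only [sum_range_limitLaw_succ]
    simpa using tendsto_centralBinom_div_four_pow.const_sub 1

theorem isLimitSolution_iff_isConvLaw {q : ℕ → ℝ} :
    IsLimitSolution q ↔ IsConvLaw (fun _ => 2) q := by
  have hbalance (a b : ℝ) : a = 1 / 2 * b ↔ 2 * a = b := by
    constructor <;> intro h <;> linarith
  exact ⟨fun h => ⟨⟨h.zero, h.nonneg, fun k hk => (hbalance _ _).1 (h.balance k hk)⟩, h.hasSum⟩,
    fun h => ⟨h.zero, h.nonneg, h.hasSum, fun k hk => (hbalance _ _).2 (h.balance k hk)⟩⟩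

theorem limitLaw_isEquivalent :
    limitLaw ~[atTop] fun k : ℕ => 1 / (2 * √Real.pi * (k : ℝ) ^ (3 / 2 : ℝ)) := by
  have hdiv := centralBinom_div_four_pow_isEquivalent.div
    (isEquivalent_natCast_mul_add two_ne_zero (-1))
  refine (hdiv.congr_left ?_).congr_right (.of_eq ?_)
  · filter_upwards [eventually_ge_atTop 1] with k hk
    obtain ⟨k, rfl⟩ := Nat.exists_eq_add_of_le' hk
    rw [Pi.div_apply, limitLaw_succ_eq_centralBinom_succ]
    push_cast
    congr 1
    ring
  · ext k
    rcases k.eq_zero_or_pos with rfl | hk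
    · simp
    have hk : (0 : ℝ) < k := by exact_mod_cast hk
    rw [Pi.div_apply, show (3 / 2 : ℝ) = 1 + 1 / 2 by norm_num, Real.rpow_add hk, Real.rpow_one,
      ← Real.sqrt_eq_rpow, Real.sqrt_mul Real.pi_pos.le]
    field_simp

end LimitLaw

section Equilibrium

/-- The weights `2 + (k - 1) / n` of the system with fire rate `1 / n`. -/
noncomputable def fireWeight (n k : ℕ) : ℝ := 2 + ((k : ℝ) - 1) / n

theorem two_le_fireWeight (n : ℕ) {k : ℕ} (hk : 1 ≤ k) : 2 ≤ fireWeight n k :=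
  le_add_of_nonneg_right (div_nonneg (sub_nonneg.2 (by exact_mod_cast hk)) n.cast_nonneg)

theorem fireWeight_pos (n : ℕ) {k : ℕ} (hk : 1 ≤ k) : 0 < fireWeight n k :=
  two_pos.trans_le (two_le_fireWeight n hk)

theorem tendsto_fireWeight_apply (k : ℕ) : Tendsto (fun n => fireWeight n k) atTop (𝓝 2) := by
  simpa [fireWeight] using (tendsto_const_div_atTop_nhds_zero_nat ((k : ℝ) - 1)).const_add 2

theorem tendsto_fireWeight_atTop {n : ℕ} (hn : 1 ≤ n) : Tendsto (fireWeight n) atTop atTop :=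
  tendsto_atTop_add_const_left _ _ <|
    (tendsto_atTop_add_const_right _ _ tendsto_natCast_atTop_atTop).atTop_div_const
      (by exact_mod_cast hn)

theorem moment_zero_eq_tsum (u : ℕ → ℝ) : moment 0 u = ∑' k, u (k + 1) := by
  simp only [moment, pow_zero, one_mul]

theorem moment_div (i : ℕ) (u : ℕ → ℝ) (a : ℝ) :
    moment i (fun k => u k / a) = moment i u / a := by
  simp only [moment, ← mul_div_assoc, tsum_div_const]

variable {n : ℕ} {c c' q : ℕ → ℝ}

theorem IsEquilibrium.summable (h : IsEquilibrium n c) : Summable fun k => c (k + 1) := by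
  have hmass : Summable fun k : ℕ => ((k + 1 : ℕ) : ℝ) ^ 1 * c (k + 1) := by
    by_contra hdiv
    exact zero_ne_one ((tsum_eq_zero_of_not_summable hdiv).symm.trans h.mass)
  exact hmass.of_nonneg_of_le (fun k => h.nonneg _) fun k =>
    le_mul_of_one_le_left (h.nonneg _) (by simp)

theorem IsEquilibrium.moment_zero_pos (h : IsEquilibrium n c) : 0 < moment 0 c := by
  rw [moment_zero_eq_tsum]
  refine (tsum_nonneg fun k => h.nonneg _).lt_of_ne fun h0 => ?_
  have hzero := h.summable.hasSum
  rw [← h0, hasSum_zero_iff_of_nonneg fun k => h.nonneg _] at hzero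
  have hmass := h.mass
  simp [moment, fun k => congrFun hzero k] at hmass

theorem IsEquilibrium.isConvLaw_massDist (h : IsEquilibrium n c) :
    IsConvLaw (fireWeight n) (massDist c) where
  zero := by rw [massDist, h.zero, zero_div]
  nonneg k := div_nonneg (h.nonneg k) h.moment_zero_pos.le
  balance k hk := by
    have h0 := h.moment_zero_pos.ne'
    simp only [massDist, div_mul_div_comm]
    rw [← Finset.sum_div, fireWeight, ← mul_div_assoc, h.balance k hk]
    field_simp
  hasSum := by
    have hdiv := h.summable.hasSum.div_const (moment 0 c)
    rwa [← moment_zero_eq_tsum, div_self h.moment_zero_pos.ne'] at hdiv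

theorem IsEquilibrium.eq_massDist_div (h : IsEquilibrium n c) (k : ℕ) :
    c k = massDist c k / moment 1 (massDist c) := by
  have h1 : moment 1 (massDist c) = 1 / moment 0 c := by
    rw [← h.mass]
    exact moment_div 1 c (moment 0 c)
  rw [h1, massDist, div_div_div_cancel_right₀ h.moment_zero_pos.ne', div_one]

theorem IsEquilibrium.unique (h : IsEquilibrium n c) (h' : IsEquilibrium n c') : c = c' := by
  funext k
  rw [h.eq_massDist_div, h'.eq_massDist_div, h.isConvLaw_massDist.unique
    (fun _ hk => fireWeight_pos n (one_le_two.trans hk)) h'.isConvLaw_massDist]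

theorem IsConvLaw.isEquilibrium (h : IsConvLaw (fireWeight n) q)
    (hs : Summable fun k : ℕ => ((k + 1 : ℕ) : ℝ) ^ 1 * q (k + 1)) :
    IsEquilibrium n fun k => q k / moment 1 q := by
  have hpos : 0 < moment 1 q := one_pos.trans_le <|
    hasSum_le (fun k => le_mul_of_one_le_left (h.nonneg _) (by simp)) h.hasSum hs.hasSum
  have h0 : moment 0 (fun k => q k / moment 1 q) = 1 / moment 1 q := by
    rw [moment_div, moment_zero_eq_tsum, h.hasSum.tsum_eq]
  refine ⟨by rw [h.zero, zero_div], fun k => div_nonneg (h.nonneg k) hpos.le, ?_, fun k hk => ?_⟩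
  · rw [moment_div, div_self hpos.ne']
  · have hb := h.balance k hk
    rw [fireWeight] at hb
    rw [h0, one_div_one_div, ← mul_div_assoc, hb]
    simp only [div_mul_div_comm, ← Finset.sum_div]
    field_simp

theorem existsUnique_isEquilibrium (hn : 1 ≤ n) : ∃! c, IsEquilibrium n c := by
  obtain ⟨q, hq, hs⟩ := exists_isConvLaw
    (fun _ hk => fireWeight_pos n (one_le_two.trans hk)) (tendsto_fireWeight_atTop hn)
  exact ⟨_, hq.isEquilibrium (hs 1), fun c hc => hc.unique (hq.isEquilibrium (hs 1))⟩

theorem tendsto_massDist {c : ℕ → ℕ → ℝ} (h : ∀ n, 1 ≤ n → IsEquilibrium n (c n)) (k : ℕ) :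
    Tendsto (fun n => massDist (c n) k) atTop (𝓝 (limitLaw k)) := by
  refine isConvLaw_limitLaw.tendsto (w := fireWeight) (fun _ _ => two_pos)
    (.of_forall fun n k hk => two_le_fireWeight n (one_le_two.trans hk))
    (fun k _ => tendsto_fireWeight_apply k) ?_ k
  filter_upwards [eventually_ge_atTop 1] with n hn using (h n hn).isConvLaw_massDist

theorem tendsto_tsum_abs_massDist_sub_limitLaw {c : ℕ → ℕ → ℝ}
    (h : ∀ n, 1 ≤ n → IsEquilibrium n (c n)) :
    Tendsto (fun n => ∑' k, |massDist (c n) (k + 1) - limitLaw (k + 1)|) atTop (𝓝 0) := by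
  have hlaw : ∀ᶠ n in atTop, IsConvLaw (fireWeight n) (massDist (c n)) := by
    filter_upwards [eventually_ge_atTop 1] with n hn using (h n hn).isConvLaw_massDist
  exact tendsto_tsum_abs_sub_of_hasSum (hlaw.mono fun n hn k => hn.nonneg (k + 1))
    (hlaw.mono fun n hn => hn.hasSum) (fun k => limitLaw_nonneg (k + 1))
    isConvLaw_limitLaw.hasSum (tendsto_pi_nhds.2 fun k => tendsto_massDist h (k + 1))

end Equilibrium

section Leaves

theorem nil_mem_tree (ξ : List ℕ → ℕ) : [] ∈ tree ξ := by
  intro v i h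
  simp at h

theorem cons_mem_tree {ξ : List ℕ → ℕ} {i : ℕ} {u : List ℕ} :
    i :: u ∈ tree ξ ↔ i < ξ [] ∧ u ∈ tree fun v => ξ (i :: v) := by
  constructor
  · intro h
    refine ⟨h [] i (by simp), fun v j hv => h (i :: v) j ?_⟩
    simpa using hv
  · rintro ⟨hi, hu⟩ v j hv
    rcases v with _ | ⟨a, v⟩
    · rw [List.nil_append, List.cons_prefix_cons] at hv
      exact hv.1 ▸ hi
    · rw [List.cons_append, List.cons_prefix_cons] at hv
      obtain ⟨rfl, hv⟩ := hv
      exact hu v j hv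

theorem nil_mem_leaves {ξ : List ℕ → ℕ} : [] ∈ leaves ξ ↔ ξ [] = 0 :=
  and_iff_right (nil_mem_tree ξ)

theorem cons_mem_leaves {ξ : List ℕ → ℕ} {i : ℕ} {u : List ℕ} :
    i :: u ∈ leaves ξ ↔ i < ξ [] ∧ u ∈ leaves fun v => ξ (i :: v) := by
  change i :: u ∈ tree ξ ∧ _ ↔ _ ∧ u ∈ tree _ ∧ _
  rw [cons_mem_tree, and_assoc]

theorem encard_leaves_of_root_eq_zero {ξ : List ℕ → ℕ} (h : ξ [] = 0) :
    (leaves ξ).encard = 1 := by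
  rw [Set.encard_eq_one]
  refine ⟨[], Set.ext fun u => ?_⟩
  rcases u with _ | ⟨i, u⟩
  · simp [nil_mem_leaves, h]
  · simp [cons_mem_leaves, h]

theorem encard_leaves_of_root_eq_two {ξ : List ℕ → ℕ} (h : ξ [] = 2) :
    (leaves ξ).encard =
      (leaves fun v => ξ (0 :: v)).encard + (leaves fun v => ξ (1 :: v)).encard := by
  have hunion : leaves ξ = List.cons 0 '' (leaves fun v => ξ (0 :: v)) ∪
      List.cons 1 '' (leaves fun v => ξ (1 :: v)) := by
    ext u
    rcases u with _ | ⟨i, u⟩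
    · simp [nil_mem_leaves, h]
    · rcases i with _ | _ | i <;> simp [cons_mem_leaves, h]
  rw [hunion, Set.encard_union_eq, List.cons_injective.encard_image,
    List.cons_injective.encard_image]
  rw [Set.disjoint_left]
  rintro _ ⟨u, -, rfl⟩ ⟨v, -, hv⟩
  simp at hv

theorem measurableSet_mem_leaves (u : List ℕ) :
    MeasurableSet {ξ : List ℕ → ℕ | u ∈ leaves ξ} := by
  have h : {ξ : List ℕ → ℕ | u ∈ leaves ξ} =
      (⋂ (v : List ℕ) (i : ℕ) (_ : v ++ [i] <+: u), {ξ | i < ξ v}) ∩ {ξ | ξ u = 0} := by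
    ext ξ
    simp [leaves, tree]
  rw [h]
  refine .inter (.iInter fun v => .iInter fun i => .iInter fun _ => ?_) ?_
  · exact measurable_pi_apply v (MeasurableSet.of_discrete (s := Set.Ioi i))
  · exact measurable_pi_apply u (measurableSet_singleton 0)

theorem measurable_encard_leaves : Measurable fun ξ : List ℕ → ℕ => (leaves ξ).encard :=
  measurable_encard.comp <| measurable_set_iff.2 fun u =>
    measurableSet_setOfPred.1 (measurableSet_mem_leaves u)

end Leaves

section Independence

theorem comap_pi_le_iSup_comap {Ω ι α E : Type*} [MeasurableSpace E] (f : ι → Ω → E)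
    (g : α → ι) :
    MeasurableSpace.comap (fun ω a => f (g a) ω) inferInstance ≤
      ⨆ i ∈ Set.range g, MeasurableSpace.comap (f i) inferInstance := by
  simp only [MeasurableSpace.pi, MeasurableSpace.comap_iSup, MeasurableSpace.comap_comp,
    iSup_range]
  exact le_rfl

variable {Ω : Type*} [MeasurableSpace Ω] {P : Measure Ω}

theorem indepFun_comp_of_disjoint_range {ι α β E : Type*} [MeasurableSpace E] {f : ι → Ω → E}
    (h : iIndepFun f P) (hf : ∀ i, Measurable (f i)) {g : α → ι} {g' : β → ι}
    (hg : Disjoint (Set.range g) (Set.range g')) :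
    IndepFun (fun ω a => f (g a) ω) (fun ω b => f (g' b) ω) P := by
  rw [IndepFun_iff_Indep]
  exact indep_of_indep_of_le_left (indep_of_indep_of_le_right
    (indep_iSup_of_disjoint (fun i => (hf i).comap_le) h.iIndep hg)
    (comap_pi_le_iSup_comap f g')) (comap_pi_le_iSup_comap f g)

theorem measureReal_inter_preimage_eq_mul_of_indepFun {E F : Type*} [MeasurableSpace E]
    [MeasurableSpace F] {X : Ω → E} {Y : Ω → F} (h : IndepFun X Y P) {s : Set E} {t : Set F}
    (hs : MeasurableSet s) (ht : MeasurableSet t) :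
    P.real (X ⁻¹' s ∩ Y ⁻¹' t) = P.real (X ⁻¹' s) * P.real (Y ⁻¹' t) := by
  simp only [measureReal_def, h.measure_inter_preimage_eq_mul s t hs ht, ENNReal.toReal_mul]

theorem measureReal_add_eq_natCast_of_indepFun [IsFiniteMeasure P] {X Y : Ω → ℕ∞}
    (hX : Measurable X) (hY : Measurable Y) (h : IndepFun X Y P) (k : ℕ) :
    P.real {ω | X ω + Y ω = k} =
      ∑ ij ∈ antidiagonal k, P.real {ω | X ω = ij.1} * P.real {ω | Y ω = ij.2} := by
  have hunion : {ω | X ω + Y ω = k} =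
      ⋃ ij ∈ antidiagonal k, X ⁻¹' {(ij.1 : ℕ∞)} ∩ Y ⁻¹' {(ij.2 : ℕ∞)} := by
    ext ω
    simp only [Set.mem_ofPred_eq, Set.mem_iUnion, Set.mem_inter_iff, Set.mem_preimage,
      Set.mem_singleton_iff, exists_prop, Prod.exists, mem_antidiagonal]
    constructor
    · intro hk
      obtain ⟨hXt, hYt⟩ := WithTop.add_ne_top.1 (hk ▸ ENat.natCast_ne_top k)
      lift X ω to ℕ using hXt with i
      lift Y ω to ℕ using hYt with j
      exact ⟨i, j, by exact_mod_cast hk, rfl, rfl⟩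
    · rintro ⟨i, j, rfl, hi, hj⟩
      rw [hi, hj, Nat.cast_add]
  rw [hunion, measureReal_biUnion_finset]
  · exact Finset.sum_congr rfl fun ij _ =>
      measureReal_inter_preimage_eq_mul_of_indepFun h (.singleton _) (.singleton _)
  · rintro ij - kl - hne
    refine Set.disjoint_left.2 ?_
    rintro ω ⟨hi, hj⟩ ⟨hk, hl⟩
    exact hne (Prod.ext (by exact_mod_cast hi.symm.trans hk) (by exact_mod_cast hj.symm.trans hl))
  · exact fun ij _ => (hX (.singleton _)).inter (hY (.singleton _))

end Independence

section GaltonWatson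

variable {Ω : Type*} [MeasurableSpace Ω] {P : Measure Ω} {ν : Measure ℕ} {ξ : List ℕ → Ω → ℕ}

theorem criticalBinary_singleton_zero : criticalBinary {0} = 2⁻¹ := by
  simp [criticalBinary]

theorem criticalBinary_singleton_two : criticalBinary {2} = 2⁻¹ := by
  simp [criticalBinary]

theorem criticalBinary_compl : criticalBinary {0, 2}ᶜ = 0 := by
  simp [criticalBinary]

namespace IsGaltonWatson

theorem subtree (h : IsGaltonWatson P ν ξ) (i : ℕ) :
    IsGaltonWatson P ν fun u => ξ (i :: u) where
  measurable _ := h.measurable _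
  indep := h.indep.precomp List.cons_injective
  law _ := h.law _

theorem measure_root (h : IsGaltonWatson P ν ξ) (s : Set ℕ) : P (ξ [] ⁻¹' s) = ν s := by
  rw [← h.law [], Measure.map_apply (h.measurable []) MeasurableSet.of_discrete]

theorem measurable_pi (h : IsGaltonWatson P ν ξ) : Measurable fun ω u => ξ u ω :=
  measurable_pi_iff.2 h.measurable

theorem identDistrib_subtree (h : IsGaltonWatson P ν ξ) (i : ℕ) :
    IdentDistrib (fun ω u => ξ (i :: u) ω) (fun ω u => ξ u ω) P P :=
  .pi (fun u => ⟨(h.measurable _).aemeasurable, (h.measurable u).aemeasurable,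
    (h.law _).trans (h.law u).symm⟩) (h.subtree i).indep h.indep

theorem measurable_encard_leaves (h : IsGaltonWatson P ν ξ) :
    Measurable fun ω => (leaves fun u => ξ u ω).encard :=
  ForestFire.measurable_encard_leaves.comp h.measurable_pi

theorem measureReal_encard_leaves_subtree (h : IsGaltonWatson P ν ξ) (i : ℕ) (k : ℕ∞) :
    P.real {ω | (leaves fun u => ξ (i :: u) ω).encard = k} =
      P.real {ω | (leaves fun u => ξ u ω).encard = k} :=
  congrArg ENNReal.toReal <| ((h.identDistrib_subtree i).comp
    ForestFire.measurable_encard_leaves).measure_mem_eq (measurableSet_singleton k)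

theorem indepFun_subtrees (h : IsGaltonWatson P ν ξ) {i j : ℕ} (hij : i ≠ j) :
    IndepFun (fun ω u => ξ (i :: u) ω) (fun ω u => ξ (j :: u) ω) P := by
  refine indepFun_comp_of_disjoint_range h.indep h.measurable (Set.disjoint_left.2 ?_)
  rintro _ ⟨u, rfl⟩ ⟨v, hv⟩
  exact hij (List.cons.inj hv).1.symm

theorem indepFun_root_subtrees (h : IsGaltonWatson P ν ξ) :
    IndepFun (ξ []) (fun ω i u => ξ (i :: u) ω) P := by
  have hpair : IndepFun (fun ω (_ : Unit) => ξ [] ω)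
      (fun ω (v : ℕ × List ℕ) => ξ (v.1 :: v.2) ω) P := by
    refine indepFun_comp_of_disjoint_range h.indep h.measurable (Set.disjoint_left.2 ?_)
    rintro _ ⟨_, rfl⟩ ⟨v, hv⟩
    exact List.cons_ne_nil _ _ hv
  have hcurry : Measurable fun (η : ℕ × List ℕ → ℕ) i u => η (i, u) := by fun_prop
  exact hpair.comp (measurable_pi_apply ()) hcurry

theorem measureReal_root_eq_two_inter_encard_leaves_eq (h : IsGaltonWatson P ν ξ) (k : ℕ) :
    P.real (ξ [] ⁻¹' {2} ∩ {ω | (leaves fun u => ξ u ω).encard = k}) =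
      ν.real {2} * ∑ ij ∈ antidiagonal k, P.real {ω | (leaves fun u => ξ u ω).encard = ij.1} *
        P.real {ω | (leaves fun u => ξ u ω).encard = ij.2} := by
  have hP := h.indep.isProbabilityMeasure
  let N : (List ℕ → ℕ) → ℕ∞ := fun ζ => (leaves ζ).encard
  have hN : Measurable N := ForestFire.measurable_encard_leaves
  calc P.real (ξ [] ⁻¹' {2} ∩ {ω | N (fun u => ξ u ω) = k})
      = P.real (ξ [] ⁻¹' {2} ∩
          {ω | N (fun u => ξ (0 :: u) ω) + N (fun u => ξ (1 :: u) ω) = k}) := by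
        congr 1
        ext ω
        refine and_congr_right fun h2 => ?_
        exact Eq.congr_left (encard_leaves_of_root_eq_two (ξ := fun u => ξ u ω) h2)
    _ = P.real (ξ [] ⁻¹' {2}) *
          P.real {ω | N (fun u => ξ (0 :: u) ω) + N (fun u => ξ (1 :: u) ω) = k} := by
        have hsum : Measurable fun η : ℕ → List ℕ → ℕ => N (η 0) + N (η 1) := by fun_prop
        exact measureReal_inter_preimage_eq_mul_of_indepFun h.indepFun_root_subtrees
          (.singleton 2) (hsum (.singleton (k : ℕ∞)))
    _ = _ := by
        rw [measureReal_def, h.measure_root, ← measureReal_def,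
          measureReal_add_eq_natCast_of_indepFun (h.subtree 0).measurable_encard_leaves
            (h.subtree 1).measurable_encard_leaves
            ((h.indepFun_subtrees zero_ne_one).comp hN hN)]
        simp only [h.measureReal_encard_leaves_subtree]

theorem measureReal_root_eq_zero_inter_encard_leaves_eq (h : IsGaltonWatson P ν ξ) (k : ℕ) :
    P.real (ξ [] ⁻¹' {0} ∩ {ω | (leaves fun u => ξ u ω).encard = k}) =
      if k = 1 then ν.real {0} else 0 := by
  have hinter : ξ [] ⁻¹' {0} ∩ {ω | (leaves fun u => ξ u ω).encard = k} =
      {ω ∈ ξ [] ⁻¹' {0} | k = 1} := by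
    ext ω
    refine and_congr_right fun h0 => ?_
    change (leaves fun u => ξ u ω).encard = k ↔ k = 1
    rw [encard_leaves_of_root_eq_zero (ξ := fun u => ξ u ω) h0, eq_comm, Nat.cast_eq_one]
  rw [hinter]
  split_ifs with hk
  · rw [measureReal_def, measureReal_def, ← h.measure_root]
    simp only [hk, and_true, Set.ofPred_mem_eq]
  · simp [hk]

theorem measureReal_encard_leaves_eq (h : IsGaltonWatson P criticalBinary ξ) (k : ℕ) :
    2 * P.real {ω | (leaves fun u => ξ u ω).encard = k} = (if k = 1 then 1 else 0) +
      ∑ ij ∈ antidiagonal k, P.real {ω | (leaves fun u => ξ u ω).encard = ij.1} *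
        P.real {ω | (leaves fun u => ξ u ω).encard = ij.2} := by
  have hP := h.indep.isProbabilityMeasure
  set L := {ω | (leaves fun u => ξ u ω).encard = k}
  have hroot : ∀ᵐ ω ∂P, ω ∈ ξ [] ⁻¹' {0, 2} := by
    rw [ae_iff]
    exact (h.measure_root {0, 2}ᶜ).trans criticalBinary_compl
  have hdiff : (L \ ξ [] ⁻¹' {0} : Set Ω) =ᵐ[P] (ξ [] ⁻¹' {2} ∩ L : Set Ω) := by
    filter_upwards [hroot] with ω hω
    refine propext ⟨fun hl => ⟨hω.resolve_left hl.2, hl.1⟩, fun hl => ⟨hl.2, fun h0 => ?_⟩⟩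
    exact two_ne_zero (hl.1.symm.trans h0)
  have hzero : criticalBinary.real {0} = 1 / 2 := by
    simp [measureReal_def, criticalBinary_singleton_zero]
  have htwo : criticalBinary.real {2} = 1 / 2 := by
    simp [measureReal_def, criticalBinary_singleton_two]
  rw [← measureReal_inter_add_sdiff (s := L) (h.measurable [] (measurableSet_singleton 0)),
    measureReal_congr hdiff, Set.inter_comm L,
    h.measureReal_root_eq_zero_inter_encard_leaves_eq,
    h.measureReal_root_eq_two_inter_encard_leaves_eq, hzero, htwo]
  split_ifs <;> ring

theorem measureReal_encard_leaves_eq_zero (h : IsGaltonWatson P criticalBinary ξ) :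
    P.real {ω | (leaves fun u => ξ u ω).encard = 0} = 0 := by
  have hP := h.indep.isProbabilityMeasure
  have hle : P.real {ω | (leaves fun u => ξ u ω).encard = 0} ≤ 1 := measureReal_le_one
  have hquad := h.measureReal_encard_leaves_eq 0
  simp only [Finset.Nat.antidiagonal_zero, Finset.sum_singleton, Nat.cast_zero,
    if_neg zero_ne_one, zero_add] at hquad
  nlinarith

theorem isConvSolution_encard_leaves (h : IsGaltonWatson P criticalBinary ξ) :
    IsConvSolution (fun _ => 2) fun k => P.real {ω | (leaves fun u => ξ u ω).encard = k} where
  zero := h.measureReal_encard_leaves_eq_zero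
  nonneg _ := measureReal_nonneg
  balance k hk := by
    obtain ⟨k, rfl⟩ := Nat.exists_eq_add_of_le' hk
    rw [sum_Ico_one_eq_sum_antidiagonal fun i j =>
      P.real {ω | (leaves fun u => ξ u ω).encard = i} *
        P.real {ω | (leaves fun u => ξ u ω).encard = j},
      h.measureReal_encard_leaves_eq, Finset.Nat.antidiagonal_succ_succ']
    simp [h.measureReal_encard_leaves_eq_zero, -Set.encard_eq_zero]

theorem measureReal_encard_leaves_eq_one (h : IsGaltonWatson P criticalBinary ξ) :
    P.real {ω | (leaves fun u => ξ u ω).encard = 1} = 1 / 2 := by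
  have hone : 2 * P.real {ω | (leaves fun u => ξ u ω).encard = 1} = 1 := by
    simpa [Finset.Nat.antidiagonal_succ, h.measureReal_encard_leaves_eq_zero,
      -Set.encard_eq_zero] using h.measureReal_encard_leaves_eq 1
  linarith

theorem measure_encard_leaves_eq_limitLaw (h : IsGaltonWatson P criticalBinary ξ) (k : ℕ) :
    P {ω | (leaves fun u => ξ u ω).encard = k} = ENNReal.ofReal (limitLaw k) := by
  have hP := h.indep.isProbabilityMeasure
  have hlaw := h.isConvSolution_encard_leaves.eq_of_apply_one (fun _ _ => two_pos)
    isConvLaw_limitLaw.toIsConvSolution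
    (by simpa [limitLaw_one] using h.measureReal_encard_leaves_eq_one)
  rw [← congrFun hlaw k, ofReal_measureReal]

end IsGaltonWatson

end GaltonWatson

end ForestFire

theorem theorem2 :
    (∀ n : ℕ, 1 ≤ n → ∃! c : ℕ → ℝ, ForestFire.IsEquilibrium n c) ∧
    (∀ c : ℕ → ℕ → ℝ, (∀ n, 1 ≤ n → ForestFire.IsEquilibrium n (c n)) →
      (∀ n, 1 ≤ n → (∀ k, 0 ≤ ForestFire.massDist (c n) k) ∧
        HasSum (fun k => ForestFire.massDist (c n) (k + 1)) 1) ∧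
      (∀ n, 1 ≤ n → Summable
        (fun k => |ForestFire.massDist (c n) (k + 1) - ForestFire.limitLaw (k + 1)|)) ∧
      Tendsto
        (fun n => ∑' k, |ForestFire.massDist (c n) (k + 1) - ForestFire.limitLaw (k + 1)|)
        atTop (𝓝 0)) ∧
    (∀ (Ω : Type*) [MeasurableSpace Ω] (P : Measure Ω) [IsProbabilityMeasure P]
      (ξ : List ℕ → Ω → ℕ), ForestFire.IsGaltonWatson P ForestFire.criticalBinary ξ →
      ∀ k : ℕ, 1 ≤ k →
        P {ω | (ForestFire.leaves (fun u => ξ u ω)).encard = (k : ℕ∞)} =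
          ENNReal.ofReal (ForestFire.limitLaw k)) ∧
    (ForestFire.IsLimitSolution ForestFire.limitLaw ∧
      ∀ q : ℕ → ℝ, ForestFire.IsLimitSolution q → q = ForestFire.limitLaw) ∧
    ForestFire.limitLaw ~[atTop]
      (fun k : ℕ => 1 / (2 * Real.sqrt Real.pi * (k : ℝ) ^ (3 / 2 : ℝ))) := by
  have hlimit := ForestFire.isConvLaw_limitLaw
  refine ⟨fun n hn => ForestFire.existsUnique_isEquilibrium hn, fun c hc => ?_,
    fun Ω _ P _ ξ hξ k _ => hξ.measure_encard_leaves_eq_limitLaw k,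
    ⟨ForestFire.isLimitSolution_iff_isConvLaw.2 hlimit, fun q hq =>
      (ForestFire.isLimitSolution_iff_isConvLaw.1 hq).unique (fun _ _ => two_pos) hlimit⟩,
    ForestFire.limitLaw_isEquivalent⟩
  have hlaw := fun n hn => (hc n hn).isConvLaw_massDist
  exact ⟨fun n hn => ⟨(hlaw n hn).nonneg, (hlaw n hn).hasSum⟩,
    fun n hn => ((hlaw n hn).hasSum.summable.sub hlimit.hasSum.summable).abs,
    ForestFire.tendsto_tsum_abs_massDist_sub_limitLaw hc⟩
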